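/- Let $k$ be an infinite field, $n\ge 1$, and let $a_0=0<a_1<\dots<a_n=d$ be integers with $\gcd(a_1,\dots,a_n)=1$. Let $\mathcal{S}_1\subset\mathbb{N}$ be the numerical semigroup generated by $a_1,\dots,a_n$, and let ${\rm Ap}_1=\{y\in\mathcal{S}_1 : y-d\notin\mathcal{S}_1\}$ be its Apery set with respect to $d$, ordered by $y\le_1 z \Leftrightarrow z-y\in\mathcal{S}_1$. Let $I_{\mathcal{A}_1}\subset k[x_1,\dots,x_n]$ be the kernel of the homomorphism of $k$-algebras $k[x_1,\dots,x_n]\to k[t]$, $x_i\mapsto t^{a_i}$, and let $k[\mathcal{C}]=k[x_0,\dots,x_n]/I_{\mathcal{A}}$, where $I_{\mathcal{A}}$ is the kernel of $k[x_0,\dots,x_n]\to k[u,v]$, $x_i\mapsto u^{a_i}v^{d-a_i}$. A finite poset $(P,\le)$ is called graded if there is a function $\rho:P\to\mathbb{N}$ with $\rho(z)=\rho(y)+1$ whenever $z$ covers $y$. The ring $k[\mathcal{C}]$ is Cohen–Macaulay if its depth as a $k[x_0,\dots,x_n]$-module (the supremum of the lengths of the $k[\mathcal{C}]$-regular sequences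 in the ideal $(x_0,\dots,x_n)$) equals its Krull dimension. Consider the following two claims: (a) $({\rm Ap}_1,\le_1)$ is graded and $\{a_1,\dots,a_{n-1}\}$ is contained in the minimal system of generators of $\mathcal{S}_1$. (b) The variable $x_n$ appears in every non-homogeneous (for the standard grading $\deg x_i=1$) binomial of the reduced Gröbner basis of $I_{\mathcal{A}_1}$ with respect to the degree reverse lexicographic order with $x_1>x_2>\dots>x_n$. Then (b) implies (a); and if $k[\mathcal{C}]$ is Cohen–Macaulay, then (a) implies (b). -/

import Mathlib

namespace MonomialCurve

open MvPolynomial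

/-! ### The degree reverse lexicographic order -/

/-- Exponent vectors in `n` variables, to be ordered by the degree reverse lexicographic order. -/
structure DegRevLex (n : ℕ) where
  /-- the underlying exponent vector -/
  exps : Fin n →₀ ℕ

namespace DegRevLex

variable {n : ℕ}

/-- Exponent vectors and their copy `DegRevLex n`. -/
def equiv (n : ℕ) : (Fin n →₀ ℕ) ≃ DegRevLex n where
  toFun x := ⟨x⟩
  invFun x := x.exps
  left_inv _ := rfl
  right_inv _ := rfl

noncomputable instance : AddCommMonoid (DegRevLex n) := (equiv n).symm.addCommMonoid

theorem exps_add (x y : DegRevLex n) : (x + y).exps = x.exps + y.exps := rfl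

/-- First compare degrees, then compare reversed: a larger exponent at the last coordinate where
the two vectors differ makes a monomial smaller. -/
noncomputable def key (x : DegRevLex n) : ℕ ×ₗ (Colex (Fin n → ℕ))ᵒᵈ :=
  toLex (x.exps.degree, OrderDual.toDual (toColex (fun i => x.exps i)))

theorem key_injective : Function.Injective (key (n := n)) := by
  rintro ⟨x⟩ ⟨y⟩ h
  have h2 := congrArg (fun p => ofColex (OrderDual.ofDual (ofLex p).2)) h
  congr 1
  ext i
  exact congrFun h2 i

noncomputable instance : LinearOrder (DegRevLex n) := LinearOrder.lift' key key_injective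

theorem lt_iff (x y : DegRevLex n) : x < y ↔
    x.exps.degree < y.exps.degree ∨ (x.exps.degree = y.exps.degree ∧
      ∃ i, y.exps i < x.exps i ∧ ∀ j, i < j → x.exps j = y.exps j) := by
  change key x < key y ↔ _
  rw [Prod.Lex.lt_iff]
  refine or_congr Iff.rfl (and_congr Iff.rfl ?_)
  constructor
  · rintro ⟨i, hi, h⟩
    exact ⟨i, h, fun j hj => (hi j hj).symm⟩
  · rintro ⟨i, h, hi⟩
    exact ⟨i, fun j hj => (hi j hj).symm, h⟩

theorem add_lt_add_left' (x y z : DegRevLex n) (h : x < y) : x + z < y + z := by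
  rw [lt_iff] at h ⊢
  simpa [exps_add] using h

instance : IsOrderedAddMonoid (DegRevLex n) where
  add_le_add_left x y h z := by
    rcases h.lt_or_eq with h | rfl
    · exact (add_lt_add_left' x y z h).le
    · exact le_rfl

theorem equiv_monotone : Monotone (equiv n) := by
  intro x y h
  rcases eq_or_ne x y with rfl | hne
  · exact le_rfl
  refine le_of_lt ((lt_iff _ _).2 (Or.inl ?_))
  obtain ⟨z, rfl⟩ := exists_add_of_le h
  have hz : z ≠ 0 := by
    rintro rfl
    simp at hne
  change x.degree < (x + z).degree
  rw [map_add]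
  have : z.degree ≠ 0 := fun h0 => hz ((Finsupp.degree_eq_zero_iff z).1 h0)
  omega

end DegRevLex

/-- The degree reverse lexicographic order with `x₁ > x₂ > ⋯ > xₙ` as a monomial order. -/
noncomputable def degRevLex (n : ℕ) : MonomialOrder (Fin n) where
  syn := DegRevLex n
  toSyn := { toEquiv := DegRevLex.equiv n, map_add' := fun _ _ => rfl }
  toSyn_monotone := DegRevLex.equiv_monotone
  wellFoundedLT_syn :=
    haveI : WellQuasiOrderedLE (DegRevLex n) :=
      DegRevLex.equiv_monotone.wellQuasiOrderedLE_of_wellQuasiOrderedLE_of_surjective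
        (DegRevLex.equiv n).surjective
    inferInstance

open scoped MonomialOrder in
/-- `𝐱^α < 𝐱^β` iff `|α| < |β|`, or `|α| = |β|` and the last nonzero coordinate of `β - α` is
negative. -/
theorem degRevLex_lt_iff {n : ℕ} (α β : Fin n →₀ ℕ) :
    α ≺[degRevLex n] β ↔ α.degree < β.degree ∨ (α.degree = β.degree ∧
      ∃ i, β i < α i ∧ ∀ j, i < j → α j = β j) :=
  DegRevLex.lt_iff _ _

/-! ### Gröbner bases -/

section Groebner

variable {σ k : Type*} [Field k]

/-- The initial ideal of `I`. -/
noncomputable def initialIdeal (m : MonomialOrder σ) (I : Ideal (MvPolynomial σ k)) :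
    Ideal (MvPolynomial σ k) :=
  Ideal.span ((fun f => m.leadingTerm f) '' (I : Set (MvPolynomial σ k)))

/-- `G` is the reduced Gröbner basis of `I`: a finite subset of `I` whose leading terms generate
the initial ideal, all of whose elements are monic, and such that no monomial of an element of `G`
is divisible by the leading monomial of another element of `G`. -/
structure IsReducedGroebnerBasis (m : MonomialOrder σ) (I : Ideal (MvPolynomial σ k))
    (G : Set (MvPolynomial σ k)) : Prop where
  finite : G.Finite
  subset : G ⊆ I
  span_leadingTerm : Ideal.span ((fun f => m.leadingTerm f) '' G) = initialIdeal m I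
  monic : ∀ g ∈ G, m.Monic g
  reduced : ∀ g ∈ G, ∀ h ∈ G, h ≠ g → ∀ c ∈ g.support, ¬ m.degree h ≤ c

/-- `f` is a binomial `𝐱^α - 𝐱^β` with `α ≠ β`. -/
def IsBinomial (f : MvPolynomial σ k) : Prop :=
  ∃ α β : σ →₀ ℕ, α ≠ β ∧ f = monomial α 1 - monomial β 1

end Groebner

/-! ### Toric ideals and the Cohen-Macaulay property -/

/-- The toric ideal of the vectors `b i`: the kernel of `k[𝐱] → k[𝐭]`, `xᵢ ↦ 𝐭 ^ (b i)`. -/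
noncomputable def toricIdeal (k : Type*) [Field k] {σ τ : Type*} [Fintype τ] (b : σ → τ → ℕ) :
    Ideal (MvPolynomial σ k) :=
  RingHom.ker (aeval (R := k) (fun i => ∏ j, (X j : MvPolynomial τ k) ^ b i j))

/-- The depth of the `R`-module `M` in the ideal `J`: the supremum of the lengths of the
`M`-regular sequences contained in `J`. -/
noncomputable def depth {R : Type*} [CommRing R] (J : Ideal R) (M : Type*) [AddCommGroup M]
    [Module R M] : ℕ∞ :=
  ⨆ (rs : List R) (_ : RingTheory.Sequence.IsRegular M rs ∧ ∀ r ∈ rs, r ∈ J), (rs.length : ℕ∞)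

/-- `k[𝐱]/I` is Cohen-Macaulay, for a (weighted-)homogeneous ideal `I`: its depth as a
`k[𝐱]`-module, with respect to the ideal generated by the variables, is its Krull dimension. -/
def IsCohenMacaulayQuotient {σ k : Type*} [Field k] (I : Ideal (MvPolynomial σ k)) : Prop :=
  ((depth (idealOfVars σ k) (MvPolynomial σ k ⧸ I) : ℕ∞) : WithBot ℕ∞) =
    ringKrullDim (MvPolynomial σ k ⧸ I)

/-! ### Apery sets, graded posets, minimal generators -/

/-- A poset is graded if it has a rank function that increases by one along every cover. -/
def IsGradedPoset (P : Type*) [PartialOrder P] : Prop :=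
  ∃ ρ : P → ℕ, ∀ y z : P, y ⋖ z → ρ z = ρ y + 1

/-- The Apery set `{y ∈ S | y - d ∉ S}`; the difference is taken in `ℤ`. -/
def aperySet (S : AddSubmonoid ℕ) (d : ℕ) : Set ℕ :=
  {y | y ∈ S ∧ ¬ ∃ s ∈ S, y = s + d}

/-- The Apery set of `S` with respect to `d`, as a poset ordered by `y ≤ z ↔ z - y ∈ S`. -/
structure AperyPoset (S : AddSubmonoid ℕ) (d : ℕ) where
  /-- the underlying natural number -/
  val : ℕ
  mem : val ∈ aperySet S d

instance (S : AddSubmonoid ℕ) (d : ℕ) : PartialOrder (AperyPoset S d) where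
  le y z := ∃ s ∈ S, z.val = y.val + s
  le_refl y := ⟨0, S.zero_mem, rfl⟩
  le_trans := by
    rintro x y z ⟨s, hs, h⟩ ⟨t, ht, h'⟩
    exact ⟨s + t, S.add_mem hs ht, by omega⟩
  le_antisymm := by
    rintro ⟨y, hy⟩ ⟨z, hz⟩ ⟨s, hs, h⟩ ⟨t, ht, h'⟩
    simp only at h h'
    congr 1
    omega

/-- The minimal system of generators of a submonoid `S` of `ℕ`: the nonzero elements of `S` that
are not the sum of two nonzero elements of `S`. -/
def minimalGenerators (S : AddSubmonoid ℕ) : Set ℕ :=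
  {s | s ∈ S ∧ s ≠ 0 ∧ ∀ x ∈ S, ∀ y ∈ S, s = x + y → x = 0 ∨ y = 0}

/-- `minimalGenerators S` generates `S`, and every generating set of `S` contains it. -/
theorem isLeast_minimalGenerators (S : AddSubmonoid ℕ) :
    IsLeast {B : Set ℕ | AddSubmonoid.closure B = S} (minimalGenerators S) := by
  constructor
  · refine le_antisymm ((AddSubmonoid.closure_le).2 fun s hs => hs.1) fun s hs => ?_
    induction s using Nat.strong_induction_on with
    | _ s ih =>
      by_cases h0 : s = 0
      · exact h0 ▸ AddSubmonoid.zero_mem _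
      by_cases hm : s ∈ minimalGenerators S
      · exact AddSubmonoid.subset_closure hm
      simp only [minimalGenerators, Set.mem_ofPred_eq, not_and, not_forall, not_or] at hm
      obtain ⟨x, hx, y, hy, hxy, hx0, hy0⟩ := hm hs h0
      rw [hxy]
      exact AddSubmonoid.add_mem _ (ih x (by omega) hx) (ih y (by omega) hy)
  · rintro B rfl s ⟨hs, h0, hirr⟩
    induction hs using AddSubmonoid.closure_induction with
    | mem x hx => exact hx
    | zero => exact absurd rfl h0
    | add x y hx hy ihx ihy =>
      rcases hirr x hx y hy rfl with rfl | rfl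
      · simp only [zero_add] at *
        exact ihy h0 hirr
      · simp only [add_zero] at *
        exact ihx h0 hirr

/-! ### The monomial curve of a sequence `a₀ = 0 < a₁ < ⋯ < aₙ = d`, with `n = m + 1`

The variables `x₁, …, xₙ` of the affine chart are indexed by `Fin (m + 1)` (so `xₙ` has index
`Fin.last m`), the variables `x₀, …, xₙ` of the projective curve by `Fin (m + 2)`. -/

section Curve

variable {m : ℕ} (a : Fin (m + 2) → ℕ)

/-- The numerical semigroup `𝒮₁` generated by `a₁, …, aₙ`. -/
def semigroupOne : AddSubmonoid ℕ :=
  AddSubmonoid.closure (Set.range fun i : Fin (m + 1) => a i.succ)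

/-- The poset `(Ap₁, ≤₁)`: the Apery set of `𝒮₁` with respect to `d = aₙ`. -/
abbrev AperyOne : Type := AperyPoset (semigroupOne a) (a (Fin.last (m + 1)))

/-- The toric ideal of the affine curve `xᵢ = t ^ aᵢ`, `i = 1, …, n`. -/
noncomputable def affineIdeal (k : Type*) [Field k] : Ideal (MvPolynomial (Fin (m + 1)) k) :=
  toricIdeal k (fun (i : Fin (m + 1)) (_ : Fin 1) => a i.succ)

/-- The toric ideal of the projective curve `xᵢ = u ^ aᵢ v ^ (d - aᵢ)`, `i = 0, …, n`. -/
noncomputable def projectiveIdeal (k : Type*) [Field k] : Ideal (MvPolynomial (Fin (m + 2)) k) :=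
  toricIdeal k (fun i : Fin (m + 2) => ![a i, a (Fin.last (m + 1)) - a i])

end Curve

end MonomialCurve

open MonomialCurve

/-! The value of an exponent vector `c` is `∑ cᵢ aᵢ ∈ 𝒮₁`, and its fibres are the sets of
factorizations of the elements of `𝒮₁`. Both claims are compared with a third one,
`HasHomogeneousAperyFibers`: all factorizations of an element of `Ap₁` have the same length.

* It is equivalent to `Ap₁` being graded with `a₁, …, aₙ₋₁` minimal generators. If the length is
  well defined it is a rank function, since a cover in `Ap₁` adds one generator. Conversely, if the
  `aᵢ` are minimal generators, then a factorization is a saturated chain from `0`, and its length is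
  read off from the rank.

* The reduced Gröbner basis consists of binomials `𝐱 ^ γ - 𝐱 ^ δ` with `𝐱 ^ δ` the smallest monomial
  of its value (`exists_eq_monomial_sub_monomial`). No factorization of an element of `Ap₁` involves
  `xₙ`, so under claim (b) monomials with value in `Ap₁` are reduced by homogeneous binomials only,
  and all of them have the degree of their common normal form.

* If `k[𝒞]` is Cohen-Macaulay, its semigroup `𝒮 ⊆ ℕ²` contains `(p, q)` whenever it contains
  `(p + d, q)` and `(p, q + N d)`. Indeed the dimension is at least two, so there is a regular
  sequence of length two, while a power of the ideal of the variables multiplies `u ^ p v ^ q` into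
  `k[𝒞]` (`mem_range_of_two_le_depth`). Apply this to a binomial `𝐱 ^ γ - 𝐱 ^ δ` without `xₙ` whose
  value is `s + d` with `s ∈ 𝒮₁`: it provides a factorization of `s + d` which involves `xₙ` and has
  length at most `|δ|`, contradicting that `𝐱 ^ δ` is the smallest monomial
  (`value_mem_aperySet_of_isStandard`). So the value of a binomial without `xₙ` is in `Ap₁`, and the
  binomial is homogeneous. -/

namespace MonomialCurve

open MvPolynomial

/-! ### Toric ideals and their reduced Gröbner bases -/

section Toric

variable {k : Type*} [Field k] {σ τ : Type*} [Fintype τ]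

/-- The exponent of the monomial of `k[𝐭]` to which `𝐱 ^ c` is sent by `xᵢ ↦ 𝐭 ^ (b i)`. -/
noncomputable def toricDegree (b : σ → τ → ℕ) : (σ →₀ ℕ) →+ (τ →₀ ℕ) :=
  Finsupp.weight fun i => Finsupp.equivFunOnFinite.symm (b i)

theorem toricDegree_single (b : σ → τ → ℕ) (i : σ) (r : ℕ) (j : τ) :
    toricDegree b (Finsupp.single i r) j = r * b i j := by
  simp [toricDegree, Finsupp.weight_single]

theorem toricDegree_apply (b : σ → τ → ℕ) (c : σ →₀ ℕ) (j : τ) :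
    toricDegree b c j = Finsupp.weight (fun i => b i j) c := by
  simp [toricDegree, Finsupp.weight_apply, Finsupp.sum, Finsupp.finsetSum_apply]

theorem prod_X_pow_eq_monomial_symm_equivFunOnFinite (b : τ → ℕ) :
    ∏ j, (X j : MvPolynomial τ k) ^ b j = monomial (Finsupp.equivFunOnFinite.symm b) 1 := by
  rw [monomial_eq, Finsupp.prod_fintype _ _ (by simp)]
  simp

theorem aeval_monomial_eq (b : σ → τ → ℕ) (c : σ →₀ ℕ) (r : k) :
    aeval (R := k) (fun i => ∏ j, (X j : MvPolynomial τ k) ^ b i j) (monomial c r) =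
      monomial (toricDegree b c) r := by
  rw [aeval_monomial, toricDegree, Finsupp.weight_apply, monomial_finsupp_sum_index]
  simp [prod_X_pow_eq_monomial_symm_equivFunOnFinite, monomial_pow, algebraMap_eq]

theorem coeff_aeval_eq [DecidableEq τ] (b : σ → τ → ℕ) (p : MvPolynomial σ k) (e : τ →₀ ℕ) :
    coeff e (aeval (R := k) (fun i => ∏ j, (X j : MvPolynomial τ k) ^ b i j) p) =
      ∑ c ∈ p.support with toricDegree b c = e, coeff c p := by
  conv_lhs => rw [p.as_sum, map_sum, coeff_sum]
  simp_rw [aeval_monomial_eq, coeff_monomial]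
  rw [Finset.sum_filter]

theorem monomial_sub_monomial_mem_toricIdeal {b : σ → τ → ℕ} {c c' : σ →₀ ℕ}
    (h : toricDegree b c = toricDegree b c') :
    (monomial c 1 - monomial c' 1 : MvPolynomial σ k) ∈ toricIdeal k b := by
  rw [toricIdeal, RingHom.mem_ker, map_sub, aeval_monomial_eq, aeval_monomial_eq, h, sub_self]

open scoped MonomialOrder

/-- The monomial `𝐱 ^ c` is standard for the toric ideal: it is the smallest monomial of its
toric degree. -/
def IsStandard (m : MonomialOrder σ) (b : σ → τ → ℕ) (c : σ →₀ ℕ) : Prop :=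
  ∀ c', toricDegree b c' = toricDegree b c → c ≼[m] c'

theorem IsStandard.eq {m : MonomialOrder σ} {b : σ → τ → ℕ} {c c' : σ →₀ ℕ}
    (hc : IsStandard m b c) (hc' : IsStandard m b c') (h : toricDegree b c = toricDegree b c') :
    c = c' :=
  m.toSyn.injective (le_antisymm (hc c' h.symm) (hc' c h))

theorem exists_isStandard (m : MonomialOrder σ) (b : σ → τ → ℕ) (c : σ →₀ ℕ) :
    ∃ c', toricDegree b c' = toricDegree b c ∧ IsStandard m b c' := by
  obtain ⟨c', hc', hmin⟩ := (InvImage.wf m.toSyn wellFounded_lt).has_min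
    {c' | toricDegree b c' = toricDegree b c} ⟨c, rfl⟩
  exact ⟨c', hc', fun x hx => not_lt.1 (hmin x (hx.trans hc'))⟩

/-- A monomial which is not standard is divisible by the leading monomial of an element of the
reduced Gröbner basis. -/
theorem exists_degree_le_of_not_isStandard {m : MonomialOrder σ} {b : σ → τ → ℕ}
    {G : Set (MvPolynomial σ k)} (hG : IsReducedGroebnerBasis m (toricIdeal k b) G)
    {c : σ →₀ ℕ} (hc : ¬ IsStandard m b c) : ∃ g ∈ G, m.degree g ≤ c := by
  simp only [IsStandard, not_forall, not_le] at hc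
  obtain ⟨c', h, hlt⟩ := hc
  have hdeg : m.degree (monomial c' (1 : k)) ≺[m] m.degree (monomial c (1 : k)) := by
    classical
    simpa [m.degree_monomial] using hlt
  have hlt' : m.leadingTerm (monomial c 1 - monomial c' 1 : MvPolynomial σ k) = monomial c 1 := by
    classical
    rw [MonomialOrder.leadingTerm, m.leadingCoeff_sub_of_lt hdeg, m.degree_sub_of_lt hdeg]
    simp [m.degree_monomial]
  have hmem : (monomial c 1 : MvPolynomial σ k) ∈ initialIdeal m (toricIdeal k b) :=
    Ideal.subset_span ⟨_, monomial_sub_monomial_mem_toricIdeal h.symm, hlt'⟩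
  rw [← hG.span_leadingTerm] at hmem
  have himage : (fun f => m.leadingTerm f) '' G =
      (fun s => monomial s (1 : k)) '' (m.degree '' G) := by
    rw [Set.image_image]
    refine Set.image_congr fun g hg => ?_
    rw [MonomialOrder.leadingTerm, (hG.monic g hg).leadingCoeff_eq_one]
  rw [himage, mem_ideal_span_monomial_image] at hmem
  obtain ⟨_, ⟨g, hg, rfl⟩, hle⟩ := hmem c (by classical simp [support_monomial])
  exact ⟨g, hg, hle⟩

/-- In an element of the reduced Gröbner basis, every monomial but the leading one is standard. -/
theorem isStandard_of_mem_support {m : MonomialOrder σ} {b : σ → τ → ℕ}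
    {G : Set (MvPolynomial σ k)} (hG : IsReducedGroebnerBasis m (toricIdeal k b) G)
    {g : MvPolynomial σ k} (hg : g ∈ G) {c : σ →₀ ℕ} (hc : c ∈ g.support)
    (hne : c ≠ m.degree g) : IsStandard m b c := by
  by_contra h
  obtain ⟨f, hf, hle⟩ := exists_degree_le_of_not_isStandard hG h
  by_cases hfg : f = g
  · subst hfg
    exact hne (m.toSyn.injective (le_antisymm (m.le_degree hc) (m.toSyn_monotone hle)))
  · exact hG.reduced g hg f hf hfg c hc hle

/-- The reduced Gröbner basis of a toric ideal consists of binomials whose trailing term is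
standard: in each toric degree the coefficients of an element of the ideal sum to zero, while by
reducedness at most one monomial besides the leading one can occur. -/
theorem exists_eq_monomial_sub_monomial {m : MonomialOrder σ} {b : σ → τ → ℕ}
    {G : Set (MvPolynomial σ k)} (hG : IsReducedGroebnerBasis m (toricIdeal k b) G)
    {g : MvPolynomial σ k} (hg : g ∈ G) :
    ∃ c, g = monomial (m.degree g) 1 - monomial c 1 ∧ c ≠ m.degree g ∧
      toricDegree b c = toricDegree b (m.degree g) ∧ IsStandard m b c := by
  classical
  have hsum : ∀ e, ∑ c ∈ g.support with toricDegree b c = e, coeff c g = 0 := fun e => by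
    have h0 := hG.subset hg
    rw [SetLike.mem_coe, toricIdeal, RingHom.mem_ker] at h0
    rw [← coeff_aeval_eq, h0, coeff_zero]
  have hlead : coeff (m.degree g) g = 1 := (hG.monic g hg).coeff_degree
  have hstd := fun c (hc : c ∈ g.support) => isStandard_of_mem_support hG hg hc
  have hmem : m.degree g ∈ g.support := by simp [hlead]
  -- the leading coefficient has to be canceled by some other term of the same toric degree
  obtain ⟨c, hc, hne, hdeg⟩ : ∃ c ∈ g.support, c ≠ m.degree g ∧
      toricDegree b c = toricDegree b (m.degree g) := by
    by_contra! hcon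
    have h1 := hsum (toricDegree b (m.degree g))
    rw [Finset.sum_eq_single_of_mem (m.degree g) (by simp [hlead])] at h1
    · simp [hlead] at h1
    · intro c hc hne
      rw [Finset.mem_filter] at hc
      exact absurd hc.2 (hcon c hc.1 hne)
  have hcs := hstd c hc hne
  have hfib : {x ∈ g.support | toricDegree b x = toricDegree b (m.degree g)} =
      {m.degree g, c} := by
    ext x
    simp only [Finset.mem_filter, Finset.mem_insert, Finset.mem_singleton]
    constructor
    · rintro ⟨hx, hxd⟩
      by_cases hxl : x = m.degree g
      · exact Or.inl hxl
      · exact Or.inr ((hstd x hx hxl).eq hcs (hxd.trans hdeg.symm))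
    · rintro (rfl | rfl)
      · exact ⟨hmem, rfl⟩
      · exact ⟨hc, hdeg⟩
  have hcoeff : coeff c g = -1 := by
    have h1 := hsum (toricDegree b (m.degree g))
    rw [hfib, Finset.sum_pair hne.symm, hlead] at h1
    linear_combination h1
  refine ⟨c, ?_, hne, hdeg, hcs⟩
  ext x
  rw [coeff_sub, coeff_monomial, coeff_monomial]
  by_cases hxl : m.degree g = x
  · subst hxl
    simp [hlead, hne]
  by_cases hxc : c = x
  · subst hxc
    simp [hcoeff, hxl]
  rw [if_neg hxl, if_neg hxc, sub_zero]
  by_contra hx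
  have hx := mem_support_iff.2 hx
  have hxs := hstd x hx (Ne.symm hxl)
  by_cases hxd : toricDegree b x = toricDegree b (m.degree g)
  · exact hxc (hcs.eq hxs (hdeg.trans hxd.symm))
  -- a term of another toric degree would be alone in its degree
  have h1 := hsum (toricDegree b x)
  rw [Finset.sum_eq_single_of_mem x (by simpa using hx)] at h1
  · exact mem_support_iff.1 hx h1
  · intro y hy hyx
    rw [Finset.mem_filter] at hy
    have hyl : y ≠ m.degree g := fun h => hxd (h ▸ hy.2.symm)
    exact absurd ((hstd y hy.1 hyl).eq hxs hy.2) hyx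

end Toric

/-! ### Depth at least two -/

section Depth

/-- Two elements `f`, `g` that start a regular sequence on `R ⧸ I` have the colon property: if
`g p ≡ f q` modulo `I`, then `p` is a multiple of `f` modulo `I`. -/
theorem exists_sub_mul_mem_of_isWeaklyRegular {R : Type*} [CommRing R] {I : Ideal R} {f g : R}
    {rs : List R} (h : RingTheory.Sequence.IsWeaklyRegular (R ⧸ I) (f :: g :: rs)) {p q : R}
    (hpq : g * p - f * q ∈ I) : ∃ r, p - f * r ∈ I := by
  rw [RingTheory.Sequence.isWeaklyRegular_cons_iff,
    RingTheory.Sequence.isWeaklyRegular_cons_iff] at h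
  obtain ⟨-, hg, -⟩ := h
  have hz : ∀ x : R ⧸ I, (Submodule.Quotient.mk x : QuotSMulTop f (R ⧸ I)) = 0 ↔
      ∃ r : R ⧸ I, f • r = x := fun x => by
    rw [Submodule.Quotient.mk_eq_zero, Submodule.mem_smul_pointwise_iff_exists]
    simp
  have h1 : g • (Submodule.Quotient.mk (Ideal.Quotient.mk I p) : QuotSMulTop f (R ⧸ I)) = 0 := by
    rw [← Submodule.Quotient.mk_smul, hz]
    refine ⟨Ideal.Quotient.mk I q, ?_⟩
    change Ideal.Quotient.mk I (f * q) = Ideal.Quotient.mk I (g * p)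
    exact ((Ideal.Quotient.eq).2 hpq).symm
  have h2 := hg (h1.trans (smul_zero g).symm)
  obtain ⟨r, hr⟩ := (hz _).1 h2
  obtain ⟨r, rfl⟩ := Ideal.Quotient.mk_surjective r
  refine ⟨r, ?_⟩
  rw [← Ideal.Quotient.eq]
  exact hr.symm

theorem exists_isWeaklyRegular_of_two_le_depth {R : Type*} [CommRing R] {J : Ideal R}
    {M : Type*} [AddCommGroup M] [Module R M] (h : 2 ≤ depth J M) :
    ∃ f ∈ J, ∃ g ∈ J, ∃ rs, RingTheory.Sequence.IsWeaklyRegular M (f :: g :: rs) := by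
  have h1 : (1 : ℕ∞) < depth J M := lt_of_lt_of_le (by norm_num) h
  rw [depth, lt_iSup_iff] at h1
  obtain ⟨l, hl⟩ := h1
  rw [lt_iSup_iff] at hl
  obtain ⟨⟨hreg, hmem⟩, hlen⟩ := hl
  have hlen : 1 < l.length := by exact_mod_cast hlen
  match l, hlen with
  | f :: g :: rs, _ =>
    exact ⟨f, hmem f (by simp), g, hmem g (by simp), rs, hreg.toIsWeaklyRegular⟩

/-- If the image of `φ : R → B`, with `B` a domain, has depth at least two in `J` as an
`R`-module, then it contains every element of `B` that is multiplied into it by a power of `J`. -/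
theorem mem_range_of_two_le_depth {R B : Type*} [CommRing R] [CommRing B] [IsDomain B]
    (φ : R →+* B) {J : Ideal R} (hdepth : 2 ≤ depth J (R ⧸ RingHom.ker φ)) {N : ℕ} {h : B}
    (hJ : ∀ r ∈ J ^ N, φ r * h ∈ φ.range) : h ∈ φ.range := by
  obtain ⟨f, hf, g, hg, rs, hreg⟩ := exists_isWeaklyRegular_of_two_le_depth hdepth
  have hf0 : φ f ≠ 0 := by
    intro h0
    have h1 := ((RingTheory.Sequence.isWeaklyRegular_cons_iff _ _ _).1 hreg).1
    have h2 : f • (1 : R ⧸ RingHom.ker φ) = f • 0 := by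
      rw [smul_zero]
      change Ideal.Quotient.mk _ (f * 1) = 0
      rw [mul_one, Ideal.Quotient.eq_zero_iff_mem, RingHom.mem_ker, h0]
    have h3 : (1 : R) ∈ RingHom.ker φ := by
      rw [← Ideal.Quotient.eq_zero_iff_mem, map_one]
      exact h1 h2
    rw [RingHom.mem_ker, map_one] at h3
    exact one_ne_zero h3
  have key : ∀ x : B, φ f * x ∈ φ.range → φ g * x ∈ φ.range → x ∈ φ.range := by
    rintro x ⟨p, hp⟩ ⟨q, hq⟩
    obtain ⟨r, hr⟩ := exists_sub_mul_mem_of_isWeaklyRegular hreg (p := p) (q := q) (by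
      rw [RingHom.mem_ker, map_sub, map_mul, map_mul, hp, hq]
      ring)
    rw [RingHom.mem_ker, map_sub, map_mul, hp, ← mul_sub, mul_eq_zero, or_iff_right hf0,
      sub_eq_zero] at hr
    exact ⟨r, hr.symm⟩
  have main : ∀ K i j, i + j + K = N → φ (f ^ i * g ^ j) * h ∈ φ.range := by
    intro K
    induction K with
    | zero =>
      intro i j hij
      refine hJ _ ?_
      rw [← hij, add_zero, pow_add]
      exact Ideal.mul_mem_mul (Ideal.pow_mem_pow hf i) (Ideal.pow_mem_pow hg j)
    | succ K ih =>
      intro i j hij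
      refine key _ ?_ ?_
      · convert ih (i + 1) j (by omega) using 1
        rw [← mul_assoc, ← map_mul]
        ring_nf
      · convert ih i (j + 1) (by omega) using 1
        rw [← mul_assoc, ← map_mul]
        ring_nf
  simpa using main N 0 0 (by omega)

end Depth

/-! ### The coordinate ring of the projective curve -/

section Projective

variable {m : ℕ} {a : Fin (m + 2) → ℕ} (k : Type*) [Field k]

/-- The primes `I ⊂ P ⊂ (x₀, …, xₙ)`, where `P` is the ideal of the point `v = 0` of the curve,
form a chain of length two. -/
theorem two_le_ringKrullDim (ha_zero : a 0 = 0) (ha_mono : StrictMono a) :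
    2 ≤ ringKrullDim (MvPolynomial (Fin (m + 2)) k ⧸ projectiveIdeal a k) := by
  set d := a (Fin.last (m + 1)) with hd
  have hd0 : 0 < d := ha_zero ▸ ha_mono (Fin.last_pos)
  let φ := aeval (R := k) (fun i : Fin (m + 2) =>
    ∏ j, (X j : MvPolynomial (Fin 2) k) ^ (![a i, d - a i] : Fin 2 → ℕ) j)
  let ψ := aeval (R := k) (![X 0, 0] : Fin 2 → MvPolynomial (Fin 2) k)
  let χ := aeval (R := k) (fun _ : Fin 2 => (0 : k))
  have hI : projectiveIdeal a k = RingHom.ker φ := rfl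
  have h01 : RingHom.ker φ ≤ RingHom.ker (ψ.comp φ) := fun p hp => by
    rw [RingHom.mem_ker] at hp ⊢
    rw [AlgHom.comp_apply, hp, map_zero]
  have hcomp : (χ.comp ψ) = χ := by
    ext i
    fin_cases i <;> simp [χ, ψ]
  have h12 : RingHom.ker (ψ.comp φ) ≤ RingHom.ker (χ.comp φ) := fun p hp => by
    rw [RingHom.mem_ker] at hp ⊢
    rw [← hcomp, AlgHom.comp_assoc, AlgHom.comp_apply, hp, map_zero]
  have hlast : φ (X (Fin.last (m + 1))) = X 0 ^ d := by
    simp [φ, Fin.prod_univ_two, hd]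
  have hzero : φ (X 0) = X 1 ^ d := by
    simp [φ, Fin.prod_univ_two, ha_zero]
  have h01' : RingHom.ker φ < RingHom.ker (ψ.comp φ) := by
    refine lt_of_le_not_ge h01 fun h => ?_
    have h1 : (X 0 : MvPolynomial (Fin (m + 2)) k) ∈ RingHom.ker (ψ.comp φ) := by
      rw [RingHom.mem_ker, AlgHom.comp_apply, hzero]
      simp [ψ, hd0.ne']
    have h2 := h h1
    rw [RingHom.mem_ker, hzero] at h2
    exact pow_ne_zero _ (X_ne_zero _) h2
  have h12' : RingHom.ker (ψ.comp φ) < RingHom.ker (χ.comp φ) := by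
    refine lt_of_le_not_ge h12 fun h => ?_
    have h1 : (X (Fin.last (m + 1)) : MvPolynomial (Fin (m + 2)) k) ∈
        RingHom.ker (χ.comp φ) := by
      rw [RingHom.mem_ker, AlgHom.comp_apply, hlast]
      simp [χ, hd0.ne']
    have h2 := h h1
    rw [RingHom.mem_ker, AlgHom.comp_apply, hlast] at h2
    simp [ψ] at h2
  rw [ringKrullDim_quotient, hI]
  let s : Fin 3 → PrimeSpectrum.zeroLocus
      ((RingHom.ker φ : Ideal (MvPolynomial (Fin (m + 2)) k)) : Set _) :=
    ![⟨⟨RingHom.ker φ, RingHom.ker_isPrime _⟩, (PrimeSpectrum.mem_zeroLocus _ _).2 le_rfl⟩,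
      ⟨⟨RingHom.ker (ψ.comp φ), RingHom.ker_isPrime _⟩, (PrimeSpectrum.mem_zeroLocus _ _).2 h01⟩,
      ⟨⟨RingHom.ker (χ.comp φ), RingHom.ker_isPrime _⟩,
        (PrimeSpectrum.mem_zeroLocus _ _).2 (h01.trans h12)⟩]
  have hs : StrictMono s := by
    rw [Fin.strictMono_iff_lt_succ]
    intro i
    fin_cases i
    · exact h01'
    · exact h12'
  exact Order.LTSeries.length_le_krullDim (LTSeries.mk 2 s hs)

theorem two_le_depth (ha_zero : a 0 = 0) (ha_mono : StrictMono a)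
    (hCM : IsCohenMacaulayQuotient (projectiveIdeal a k)) :
    2 ≤ depth (idealOfVars (Fin (m + 2)) k)
      (MvPolynomial (Fin (m + 2)) k ⧸ projectiveIdeal a k) := by
  have h := two_le_ringKrullDim k ha_zero ha_mono
  rw [← hCM] at h
  exact WithBot.coe_le_coe.1 h

/-- The combinatorial consequence of Cohen-Macaulayness. Let `𝒮` be the semigroup of the
exponents of the monomials in `k[𝒞]`. If `(p + d, q)` and `(p, q + N d)` are in `𝒮` for some
`N`, then so is `(p, q)`. -/
theorem exists_toricDegree_eq_of_isCohenMacaulayQuotient (ha_zero : a 0 = 0)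
    (ha_mono : StrictMono a) (hCM : IsCohenMacaulayQuotient (projectiveIdeal a k))
    {b : Fin (m + 2) → Fin 2 → ℕ} (hb : b = fun i => ![a i, a (Fin.last (m + 1)) - a i])
    {w : Fin 2 →₀ ℕ} {N : ℕ}
    (h0 : ∃ c, toricDegree b c = w + Finsupp.single 0 (a (Fin.last (m + 1))))
    (h1 : ∃ c, toricDegree b c = w + Finsupp.single 1 (N * a (Fin.last (m + 1)))) :
    ∃ c, toricDegree b c = w := by
  obtain ⟨c0, h0⟩ := h0
  obtain ⟨c1, h1⟩ := h1
  subst hb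
  set d := a (Fin.last (m + 1)) with hd
  have hd0 : 0 < d := ha_zero ▸ ha_mono (Fin.last_pos)
  set b : Fin (m + 2) → Fin 2 → ℕ := fun i => ![a i, d - a i] with hb
  set φ := aeval (R := k) (fun i => ∏ j, (X j : MvPolynomial (Fin 2) k) ^ b i j) with hφ
  -- a monomial of `k[u, v]` lies in `k[𝒞]` iff its exponent lies in the semigroup
  have hrange : (monomial w 1 : MvPolynomial (Fin 2) k) ∈ φ.toRingHom.range ↔
      ∃ c, toricDegree b c = w := by
    constructor
    · rintro ⟨p, hp⟩
      have hp : φ p = monomial w 1 := hp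
      by_contra! hcon
      have h := coeff_aeval_eq b p w
      rw [← hφ, hp, coeff_monomial, if_pos rfl, Finset.sum_eq_zero] at h
      · exact one_ne_zero h
      · intro c hc
        exact absurd (Finset.mem_filter.1 hc).2 (hcon c)
    · rintro ⟨c, rfl⟩
      exact ⟨monomial c 1, aeval_monomial_eq b c 1⟩
  rw [← hrange]
  -- `J` consists of the elements that multiply `u ^ p v ^ q` into `k[𝒞]`
  let J : Ideal (MvPolynomial (Fin (m + 2)) k) :=
    { carrier := {r | φ r * monomial w 1 ∈ φ.toRingHom.range}
      zero_mem' := by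
        rw [Set.mem_ofPred_eq, map_zero, zero_mul]
        exact zero_mem _
      add_mem' := fun {x y} hx hy => by
        rw [Set.mem_ofPred_eq] at hx hy ⊢
        rw [map_add, add_mul]
        exact add_mem hx hy
      smul_mem' := fun r x hx => by
        rw [Set.mem_ofPred_eq] at hx ⊢
        rw [smul_eq_mul, map_mul, mul_assoc]
        exact mul_mem ⟨r, rfl⟩ hx }
  have hJmon : ∀ c, (∃ c', toricDegree b c' = toricDegree b c + w) → monomial c 1 ∈ J := by
    rintro c ⟨c', hc'⟩
    refine ⟨monomial c' 1, ?_⟩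
    change φ _ = φ _ * _
    rw [hφ, aeval_monomial_eq, aeval_monomial_eq, monomial_mul, one_mul, hc']
  have hXJ : ∀ i, ∃ e, (X i : MvPolynomial (Fin (m + 2)) k) ^ e ∈ J := by
    intro i
    rcases eq_or_ne i 0 with rfl | hi
    · refine ⟨N, ?_⟩
      rw [X_pow_eq_monomial]
      refine hJmon _ ⟨c1, ?_⟩
      rw [h1]
      ext j
      fin_cases j <;> simp [toricDegree_single, hb, ha_zero, add_comm]
    · -- `xᵢ ^ d` has the same image as `xₙ ^ (a i) * x₀ ^ (d - a i)`, and `a i > 0`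
      refine ⟨d, ?_⟩
      rw [X_pow_eq_monomial]
      obtain ⟨r, hr⟩ : ∃ r, a i = r + 1 :=
        Nat.exists_eq_succ_of_ne_zero fun h => hi (ha_mono.injective (h.trans ha_zero.symm))
      obtain ⟨q, hq⟩ : ∃ q, d - a i = q := ⟨_, rfl⟩
      refine hJmon _ ⟨c0 + Finsupp.single (Fin.last (m + 1)) r +
        Finsupp.single 0 q, ?_⟩
      rw [map_add, map_add, h0]
      ext j
      fin_cases j
      · simp [toricDegree_single, hb, ha_zero, hr, ← hd]
        ring
      · simp [toricDegree_single, hb, ha_zero, hq, ← hd]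
        ring
  obtain ⟨K, hK⟩ : ∃ K, idealOfVars (Fin (m + 2)) k ^ K ≤ J := by
    refine Ideal.exists_pow_le_of_le_radical_of_fg ?_ (idealOfVars_fg _ _)
    rw [idealOfVars, Ideal.span_le]
    rintro _ ⟨i, rfl⟩
    exact hXJ i
  exact mem_range_of_two_le_depth φ.toRingHom (two_le_depth k ha_zero ha_mono hCM)
    (N := K) fun r hr => hK hr

end Projective

/-! ### Homogeneous fibres over the Apery set -/

section Apery

theorem exists_eq_add_single {σ : Type*} {c : σ →₀ ℕ} {i : σ} (h : c i ≠ 0) :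
    ∃ c', c = c' + Finsupp.single i 1 :=
  ⟨_, (Finsupp.sub_add_single_one_cancel h).symm⟩

theorem exists_eq_add_single_of_ne_zero {σ : Type*} {c : σ →₀ ℕ} (h : c ≠ 0) :
    ∃ i c', c = c' + Finsupp.single i 1 := by
  obtain ⟨i, hi⟩ := Finsupp.ne_iff.1 h
  exact ⟨i, exists_eq_add_single hi⟩

theorem mem_aperySet_of_add_mem {S : AddSubmonoid ℕ} {d y s : ℕ} (hy : y ∈ S) (hs : s ∈ S)
    (h : y + s ∈ aperySet S d) : y ∈ aperySet S d := by
  refine ⟨hy, ?_⟩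
  rintro ⟨t, ht, rfl⟩
  exact h.2 ⟨t + s, S.add_mem ht hs, by omega⟩

variable {m : ℕ} (a : Fin (m + 2) → ℕ)

/-- The value of an exponent vector: the exponent of the power of `t` to which its monomial is
sent by `xᵢ ↦ t ^ aᵢ`. -/
noncomputable def value : (Fin (m + 1) →₀ ℕ) →+ ℕ :=
  Finsupp.weight fun i => a i.succ

/-- All factorizations of an element of `Ap₁` as a sum of generators have the same length. This
is the common combinatorial content of the two claims. -/
def HasHomogeneousAperyFibers : Prop :=
  ∀ c c', value a c ∈ aperySet (semigroupOne a) (a (Fin.last (m + 1))) →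
    value a c = value a c' → c.degree = c'.degree

variable {a}

theorem value_single (i : Fin (m + 1)) (r : ℕ) :
    value a (Finsupp.single i r) = r * a i.succ := by
  simp [value, Finsupp.weight_single]

theorem value_mem_semigroupOne (c : Fin (m + 1) →₀ ℕ) : value a c ∈ semigroupOne a :=
  AddSubmonoid.mem_closure_range_iff.2 ⟨c, rfl⟩

theorem exists_value_eq_of_mem_semigroupOne {s : ℕ} (hs : s ∈ semigroupOne a) :
    ∃ c, value a c = s := by
  obtain ⟨c, hc⟩ := AddSubmonoid.mem_closure_range_iff.1 hs
  exact ⟨c, hc.symm⟩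

theorem toricDegree_eq_iff_value_eq {c c' : Fin (m + 1) →₀ ℕ} :
    toricDegree (fun (i : Fin (m + 1)) (_ : Fin 1) => a i.succ) c =
      toricDegree (fun (i : Fin (m + 1)) (_ : Fin 1) => a i.succ) c' ↔
      value a c = value a c' := by
  rw [Finsupp.ext_iff]
  simp [toricDegree_apply, value]

theorem last_eq_zero_of_value_mem_aperySet {c : Fin (m + 1) →₀ ℕ}
    (hc : value a c ∈ aperySet (semigroupOne a) (a (Fin.last (m + 1)))) :
    c (Fin.last m) = 0 := by
  by_contra h
  obtain ⟨c', rfl⟩ := exists_eq_add_single h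
  refine hc.2 ⟨value a c', value_mem_semigroupOne c', ?_⟩
  rw [map_add, value_single, one_mul, Fin.succ_last]

theorem value_mem_aperySet_of_add {c c' : Fin (m + 1) →₀ ℕ}
    (h : value a (c + c') ∈ aperySet (semigroupOne a) (a (Fin.last (m + 1)))) :
    value a c ∈ aperySet (semigroupOne a) (a (Fin.last (m + 1))) := by
  rw [map_add] at h
  exact mem_aperySet_of_add_mem (value_mem_semigroupOne c) (value_mem_semigroupOne c') h

theorem succ_pos (ha_zero : a 0 = 0) (ha_mono : StrictMono a) (i : Fin (m + 1)) :
    0 < a i.succ :=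
  ha_zero ▸ ha_mono i.succ_pos

/-- The common length of the factorizations is a rank function: an element which covers `y` has
the form `y + aᵢ`. -/
theorem HasHomogeneousAperyFibers.isGradedPoset (ha_zero : a 0 = 0) (ha_mono : StrictMono a)
    (h : HasHomogeneousAperyFibers a) : IsGradedPoset (AperyOne a) := by
  choose F hF using fun y : AperyOne a => exists_value_eq_of_mem_semigroupOne y.mem.1
  refine ⟨fun y => (F y).degree, fun y z hyz => ?_⟩
  obtain ⟨s, hs, hzs⟩ := hyz.le
  obtain ⟨c, rfl⟩ := exists_value_eq_of_mem_semigroupOne hs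
  have hc : c ≠ 0 := by
    rintro rfl
    rw [map_zero, add_zero] at hzs
    exact hyz.lt.not_ge ⟨0, zero_mem _, by omega⟩
  obtain ⟨i, c', rfl⟩ := exists_eq_add_single_of_ne_zero hc
  have hpos := succ_pos ha_zero ha_mono i
  have hval : z.val = y.val + a i.succ + value a c' := by
    rw [hzs, map_add, value_single, one_mul, add_assoc, add_comm (value a c')]
  have hmem : a i.succ ∈ semigroupOne a := AddSubmonoid.subset_closure ⟨i, rfl⟩
  let w : AperyOne a := ⟨y.val + a i.succ, mem_aperySet_of_add_mem
    (add_mem y.mem.1 hmem) (value_mem_semigroupOne c') (hval ▸ z.mem)⟩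
  have hw : w = z := by
    refine (hyz.eq_or_eq (c := w) ⟨_, hmem, rfl⟩
      ⟨_, value_mem_semigroupOne c', hval⟩).resolve_left fun hwy => ?_
    have : y.val + a i.succ = y.val := congrArg AperyPoset.val hwy
    omega
  have hwz : y.val + a i.succ = z.val := congrArg AperyPoset.val hw
  change (F z).degree = (F y).degree + 1
  rw [h (F z) (F y + Finsupp.single i 1) (by rw [hF]; exact z.mem)
    (by rw [map_add, hF, hF, value_single, one_mul, hwz]), map_add, Finsupp.degree_single]

theorem succ_mem_aperySet (ha_mono : StrictMono a) (i : Fin m) :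
    a i.castSucc.succ ∈ aperySet (semigroupOne a) (a (Fin.last (m + 1))) := by
  refine ⟨AddSubmonoid.subset_closure ⟨_, rfl⟩, ?_⟩
  rintro ⟨s, -, hs⟩
  have : a i.castSucc.succ < a (Fin.last (m + 1)) :=
    ha_mono (by rw [← Fin.succ_last, Fin.succ_lt_succ_iff]; exact Fin.castSucc_lt_last i)
  omega

/-- For `i < n` the generator `aᵢ` lies in `Ap₁`, and it has a factorization of length one. -/
theorem HasHomogeneousAperyFibers.mem_minimalGenerators (ha_zero : a 0 = 0)
    (ha_mono : StrictMono a) (h : HasHomogeneousAperyFibers a) (i : Fin m) :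
    a i.castSucc.succ ∈ minimalGenerators (semigroupOne a) := by
  refine ⟨AddSubmonoid.subset_closure ⟨_, rfl⟩, (succ_pos ha_zero ha_mono _).ne', ?_⟩
  intro x hx y hy hxy
  obtain ⟨c, rfl⟩ := exists_value_eq_of_mem_semigroupOne hx
  obtain ⟨c', rfl⟩ := exists_value_eq_of_mem_semigroupOne hy
  by_contra! hcon
  have hc : c ≠ 0 := fun h0 => hcon.1 (by rw [h0, map_zero])
  have hc' : c' ≠ 0 := fun h0 => hcon.2 (by rw [h0, map_zero])
  have hdeg := h (Finsupp.single i.castSucc 1) (c + c')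
    (by rw [value_single, one_mul]; exact succ_mem_aperySet ha_mono i)
    (by rw [value_single, one_mul, hxy, map_add])
  rw [Finsupp.degree_single, map_add] at hdeg
  have h1 : c.degree ≠ 0 := fun h0 => hc ((Finsupp.degree_eq_zero_iff c).1 h0)
  have h2 : c'.degree ≠ 0 := fun h0 => hc' ((Finsupp.degree_eq_zero_iff c').1 h0)
  omega

/-- Adding a minimal generator is a covering relation of `Ap₁`, so a factorization gives a
saturated chain from `0`, whose length is determined by the rank function. -/
theorem hasHomogeneousAperyFibers_of_isGradedPoset (hgr : IsGradedPoset (AperyOne a))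
    (hgen : ∀ i : Fin m, a i.castSucc.succ ∈ minimalGenerators (semigroupOne a)) :
    HasHomogeneousAperyFibers a := by
  obtain ⟨ρ, hρ⟩ := hgr
  have key : ∀ n (c : Fin (m + 1) →₀ ℕ), c.degree = n → ∀
      (hc : value a c ∈ aperySet (semigroupOne a) (a (Fin.last (m + 1))))
      (h0 : 0 ∈ aperySet (semigroupOne a) (a (Fin.last (m + 1)))),
      ρ ⟨value a c, hc⟩ = ρ ⟨0, h0⟩ + n := by
    intro n
    induction n with
    | zero =>
      intro c hc hmem h0
      rw [Finsupp.degree_eq_zero_iff] at hc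
      subst hc
      simp
    | succ n ih =>
      intro c hc hmem h0
      have hne : c ≠ 0 := by
        rintro rfl
        simp at hc
      obtain ⟨i, c, rfl⟩ := exists_eq_add_single_of_ne_zero hne
      rw [map_add, Finsupp.degree_single] at hc
      have hlast := last_eq_zero_of_value_mem_aperySet hmem
      have hi : i ≠ Fin.last m := by
        rintro rfl
        simp at hlast
      obtain ⟨j, rfl⟩ := Fin.exists_castSucc_eq.2 hi
      have hval : value a (c + Finsupp.single j.castSucc 1) = value a c + a j.castSucc.succ := by
        rw [map_add, value_single, one_mul]
      have hc' := value_mem_aperySet_of_add hmem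
      obtain ⟨hjS, hj0, hirr⟩ := hgen j
      have hcov : (⟨_, hc'⟩ : AperyOne a) ⋖ ⟨_, hmem⟩ := by
        refine ⟨lt_of_le_of_ne ⟨_, hjS, hval⟩ fun h => ?_, ?_⟩
        · have h := congrArg AperyPoset.val h
          simp only at h
          omega
        · rintro w hw1 hw2
          obtain ⟨s, hs, hws⟩ := hw1.le
          obtain ⟨t, ht, hwt⟩ := hw2.le
          simp only at hws hwt
          rcases hirr s hs t ht (by omega) with rfl | rfl
          · exact hw1.not_ge ⟨0, zero_mem _, by simp only; omega⟩
          · exact hw2.not_ge ⟨0, zero_mem _, by simp only; omega⟩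
      rw [hρ _ _ hcov, ih c (by omega) hc' h0, add_assoc]
  intro c c' hc hcc'
  have h0 : 0 ∈ aperySet (semigroupOne a) (a (Fin.last (m + 1))) :=
    mem_aperySet_of_add_mem (zero_mem _) hc.1 (by rwa [zero_add])
  have h1 := key _ c rfl hc h0
  have h2 := key _ c' rfl (hcc' ▸ hc) h0
  simp only [hcc'] at h1
  omega

end Apery

/-! ### Non-homogeneous elements of the reduced Gröbner basis -/

section Comparison

variable {k : Type*} [Field k]

theorem support_monomial_sub_monomial {σ : Type*} [DecidableEq σ] {c c' : σ →₀ ℕ} (h : c ≠ c') :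
    (monomial c 1 - monomial c' 1 : MvPolynomial σ k).support = {c, c'} := by
  ext x
  rw [mem_support_iff, coeff_sub, coeff_monomial, coeff_monomial, Finset.mem_insert,
    Finset.mem_singleton]
  by_cases h1 : c = x
  · subst h1
    simp [h.symm]
  · by_cases h2 : c' = x
    · subst h2
      simp [h]
    · simp [h1, h2, Ne.symm h1, Ne.symm h2]

theorem exists_isHomogeneous_monomial_sub_monomial_iff {σ : Type*} {c c' : σ →₀ ℕ} (h : c ≠ c') :
    (∃ j, (monomial c 1 - monomial c' 1 : MvPolynomial σ k).IsHomogeneous j) ↔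
      c.degree = c'.degree := by
  classical
  have key : ∀ j, (monomial c 1 - monomial c' 1 : MvPolynomial σ k).IsHomogeneous j ↔
      c.degree = j ∧ c'.degree = j := fun j => by
    rw [IsHomogeneous, IsWeightedHomogeneous]
    simp [← mem_support_iff, support_monomial_sub_monomial h, Finsupp.degree_eq_weight_one,
      Pi.one_def, -coeff_sub]
  simp only [key]
  exact ⟨fun ⟨j, h1, h2⟩ => h1.trans h2.symm, fun h => ⟨_, h, rfl⟩⟩

theorem mem_vars_monomial_sub_monomial_iff {σ : Type*} {c c' : σ →₀ ℕ} (h : c ≠ c') (i : σ) :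
    i ∈ (monomial c 1 - monomial c' 1 : MvPolynomial σ k).vars ↔ c i ≠ 0 ∨ c' i ≠ 0 := by
  classical
  rw [mem_vars_iff_mem_support, support_monomial_sub_monomial h]
  simp

variable {m : ℕ} {a : Fin (m + 2) → ℕ} {G : Set (MvPolynomial (Fin (m + 1)) k)}

open scoped MonomialOrder

/-- Reducing a monomial with value in `Ap₁` modulo `G` never involves `xₙ`, hence uses only
homogeneous binomials. So the monomial has the degree of its normal form, which depends on the
value alone. -/
theorem hasHomogeneousAperyFibers_of_last_mem_vars
    (hG : IsReducedGroebnerBasis (degRevLex (m + 1)) (affineIdeal a k) G)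
    (hb : ∀ f ∈ G, IsBinomial f → (¬ ∃ j, f.IsHomogeneous j) → Fin.last m ∈ f.vars) :
    HasHomogeneousAperyFibers a := by
  set o := degRevLex (m + 1) with ho
  have key : ∀ c₀ : Fin (m + 1) →₀ ℕ, IsStandard o (fun i (_ : Fin 1) => a i.succ) c₀ →
      value a c₀ ∈ aperySet (semigroupOne a) (a (Fin.last (m + 1))) →
      ∀ c, value a c = value a c₀ → c.degree = c₀.degree := by
    intro c₀ hstd hap c
    induction c using (InvImage.wf o.toSyn wellFounded_lt).induction with
    | _ c ih =>
      intro hc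
      by_cases hcs : IsStandard o (fun i (_ : Fin 1) => a i.succ) c
      · rw [hcs.eq hstd (toricDegree_eq_iff_value_eq.2 hc)]
      obtain ⟨g, hg, hle⟩ := exists_degree_le_of_not_isStandard hG hcs
      obtain ⟨e, hge, hne, hdeg, hes⟩ := exists_eq_monomial_sub_monomial hG hg
      obtain ⟨r, rfl⟩ := exists_add_of_le hle
      have hval := toricDegree_eq_iff_value_eq.1 hdeg
      have hap' : value a (o.degree g) ∈ aperySet (semigroupOne a) (a (Fin.last (m + 1))) :=
        value_mem_aperySet_of_add (hc ▸ hap)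
      have hhom : ∃ j, g.IsHomogeneous j := by
        by_contra hnh
        have hv := hb g hg ⟨_, _, hne.symm, hge⟩ hnh
        rw [hge, mem_vars_monomial_sub_monomial_iff hne.symm] at hv
        rcases hv with hv | hv
        · exact hv (last_eq_zero_of_value_mem_aperySet hap')
        · exact hv (last_eq_zero_of_value_mem_aperySet (hval ▸ hap'))
      rw [hge, exists_isHomogeneous_monomial_sub_monomial_iff hne.symm] at hhom
      have hlt : e + r ≺[o] o.degree g + r := by
        rw [map_add, map_add]
        exact add_lt_add_left (lt_of_le_of_ne (hes _ hdeg.symm) (o.toSyn.injective.ne hne)) _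
      have := ih (e + r) hlt (by rw [← hc, map_add, map_add, hval])
      rw [map_add] at this ⊢
      omega
  intro c c' hc hcc'
  obtain ⟨c₀, hc₀, hstd⟩ := exists_isStandard o (fun i (_ : Fin 1) => a i.succ) c
  rw [toricDegree_eq_iff_value_eq] at hc₀
  rw [key c₀ hstd (hc₀ ▸ hc) c hc₀.symm, key c₀ hstd (hc₀ ▸ hc) c' (hcc' ▸ hc₀.symm)]

theorem toricDegree_cons_zero {d : ℕ} (r : ℕ) (ha_zero : a 0 = 0) (c : Fin (m + 1) →₀ ℕ) :
    toricDegree (fun i : Fin (m + 2) => ![a i, d - a i]) (Finsupp.cons r c) 0 = value a c := by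
  rw [toricDegree_apply, value, Finsupp.weight_eq_sum, Finsupp.weight_eq_sum,
    Fin.sum_univ_succ]
  simp [ha_zero]

theorem toricDegree_zero_add_one {d : ℕ} (ha : ∀ i, a i ≤ d) (c : Fin (m + 2) →₀ ℕ) :
    toricDegree (fun i : Fin (m + 2) => ![a i, d - a i]) c 0 +
      toricDegree (fun i : Fin (m + 2) => ![a i, d - a i]) c 1 = c.degree * d := by
  rw [toricDegree_apply, toricDegree_apply, Finsupp.weight_eq_sum, Finsupp.weight_eq_sum,
    ← Finset.sum_add_distrib, Finsupp.degree_eq_sum, Finset.sum_mul]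
  refine Finset.sum_congr rfl fun i _ => ?_
  simp [← mul_add, ha i]

theorem degree_cons (r : ℕ) (c : Fin (m + 1) →₀ ℕ) :
    (Finsupp.cons r c).degree = r + c.degree := by
  rw [Finsupp.degree_eq_sum, Finsupp.degree_eq_sum, Fin.sum_univ_succ]
  simp

/-- Suppose a standard monomial `𝐱 ^ c` without `xₙ` had value `s + d` with `s ∈ 𝒮₁`. By the
Cohen-Macaulay property `s` has a factorization of length at most `|c| - 1`. Together with one
`xₙ` it gives a monomial with the value of `𝐱 ^ c` that is smaller, because `xₙ` is the smallest
variable of a degree reverse lexicographic order. -/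
theorem value_mem_aperySet_of_isStandard (ha_zero : a 0 = 0) (ha_mono : StrictMono a)
    (hCM : IsCohenMacaulayQuotient (projectiveIdeal a k)) {c : Fin (m + 1) →₀ ℕ}
    (hc : IsStandard (degRevLex (m + 1)) (fun i (_ : Fin 1) => a i.succ) c)
    (hlast : c (Fin.last m) = 0) :
    value a c ∈ aperySet (semigroupOne a) (a (Fin.last (m + 1))) := by
  refine ⟨value_mem_semigroupOne c, ?_⟩
  rintro ⟨s, hs, hcs⟩
  obtain ⟨e, rfl⟩ := exists_value_eq_of_mem_semigroupOne hs
  set d := a (Fin.last (m + 1)) with hd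
  have hd0 : 0 < d := ha_zero ▸ ha_mono (Fin.last_pos)
  have had : ∀ i, a i ≤ d := fun i => ha_mono.monotone (Fin.le_last i)
  set b : Fin (m + 2) → Fin 2 → ℕ := fun i => ![a i, d - a i] with hb
  set q := toricDegree b (Finsupp.cons 0 c) 1 with hq
  have hcq : value a c + q = c.degree * d := by
    rw [← toricDegree_cons_zero (d := d) 0 ha_zero c, hq, toricDegree_zero_add_one had,
      degree_cons, zero_add]
  -- `N = |e| + 1` makes the length `|c| + |e|` of the second factorization at least `|e|`, so that
  -- `𝐱 ^ e` can be padded by a power of `x₀`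
  obtain ⟨x, hx⟩ := exists_toricDegree_eq_of_isCohenMacaulayQuotient k ha_zero ha_mono hCM
    (b := b) hb (w := Finsupp.single 0 (value a e) + Finsupp.single 1 q) (N := e.degree + 1)
    ⟨Finsupp.cons 0 c, by
      ext j
      fin_cases j
      · simp [hb, toricDegree_cons_zero, ha_zero, hcs, ← hd]
      · simp [← hq]⟩
    ⟨Finsupp.cons c.degree e, by
      have h1 := toricDegree_zero_add_one had (Finsupp.cons c.degree e)
      rw [degree_cons, toricDegree_cons_zero _ ha_zero, ← hb] at h1
      ext j
      fin_cases j
      · simp [hb, toricDegree_cons_zero, ha_zero]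
      · simp [← hd]
        linarith⟩
  rw [← Finsupp.cons_tail x] at hx
  have hx0 := DFunLike.congr_fun hx 0
  have hx1 := toricDegree_zero_add_one had (Finsupp.cons (x 0) x.tail)
  rw [← hb, hx, degree_cons] at hx1
  rw [toricDegree_cons_zero _ ha_zero] at hx0
  simp at hx0 hx1
  have hdeg : x 0 + x.tail.degree + 1 = c.degree :=
    Nat.eq_of_mul_eq_mul_right hd0 (by linarith)
  have hval : value a (x.tail + Finsupp.single (Fin.last m) 1) = value a c := by
    rw [map_add, value_single, hx0, hcs, one_mul, Fin.succ_last, hd]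
  refine (hc _ (toricDegree_eq_iff_value_eq.2 hval)).not_gt ?_
  rw [degRevLex_lt_iff, map_add, Finsupp.degree_single]
  rcases Nat.eq_zero_or_pos (x 0) with h0 | h0
  · refine Or.inr ⟨by omega, Fin.last m, by simp [hlast], fun j hj => ?_⟩
    exact absurd hj (Fin.le_last j).not_gt
  · exact Or.inl (by omega)

/-- An element of `G` without `xₙ` has its value in `Ap₁`, where the fibres are homogeneous. -/
theorem HasHomogeneousAperyFibers.last_mem_vars (ha_zero : a 0 = 0) (ha_mono : StrictMono a)
    (hCM : IsCohenMacaulayQuotient (projectiveIdeal a k))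
    (hG : IsReducedGroebnerBasis (degRevLex (m + 1)) (affineIdeal a k) G)
    (h : HasHomogeneousAperyFibers a) {f : MvPolynomial (Fin (m + 1)) k} (hf : f ∈ G)
    (hnh : ¬ ∃ j, f.IsHomogeneous j) : Fin.last m ∈ f.vars := by
  obtain ⟨e, hfe, hne, hdeg, hes⟩ := exists_eq_monomial_sub_monomial hG hf
  rw [toricDegree_eq_iff_value_eq] at hdeg
  by_contra hv
  rw [hfe, mem_vars_monomial_sub_monomial_iff hne.symm, not_or, not_not, not_not] at hv
  rw [hfe, exists_isHomogeneous_monomial_sub_monomial_iff hne.symm] at hnh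
  exact hnh (h _ _ (value_mem_aperySet_of_isStandard ha_zero ha_mono hCM hes hv.2) hdeg).symm

end Comparison

end MonomialCurve

theorem proposition2 {k : Type*} [Field k] [Infinite k] (m : ℕ) (a : Fin (m + 2) → ℕ)
    (ha_zero : a 0 = 0) (ha_mono : StrictMono a) (ha_gcd : Finset.univ.gcd a = 1)
    (G : Set (MvPolynomial (Fin (m + 1)) k))
    (hG : IsReducedGroebnerBasis (degRevLex (m + 1)) (affineIdeal a k) G) :
    ((∀ f ∈ G, IsBinomial f → (¬ ∃ j, f.IsHomogeneous j) → Fin.last m ∈ f.vars) →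
      IsGradedPoset (AperyOne a) ∧
        ∀ i : Fin m, a i.castSucc.succ ∈ minimalGenerators (semigroupOne a)) ∧
    (IsCohenMacaulayQuotient (projectiveIdeal a k) →
      IsGradedPoset (AperyOne a) ∧
        (∀ i : Fin m, a i.castSucc.succ ∈ minimalGenerators (semigroupOne a)) →
      ∀ f ∈ G, IsBinomial f → (¬ ∃ j, f.IsHomogeneous j) → Fin.last m ∈ f.vars) := by
  refine ⟨fun hb => ?_, fun hCM hgr f hf _ hnh => ?_⟩
  · have h := hasHomogeneousAperyFibers_of_last_mem_vars hG hb
    exact ⟨h.isGradedPoset ha_zero ha_mono, h.mem_minimalGenerators ha_zero ha_mono⟩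
  · exact (hasHomogeneousAperyFibers_of_isGradedPoset hgr.1 hgr.2).last_mem_vars
      ha_zero ha_mono hCM hG hf hnh
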